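/- For an integer $m\ge 0$ let $p(m)$ be the number of partitions of $m$, and let $p(m)=0$ for $m<0$. Let $T_k=k(k+1)/2$ denote the $k$-th triangular number. For $r\ge 1$ and a partition $\lambda$, let $g_r(\lambda)$ (the least $r$-gap of $\lambda$) be the smallest positive integer that appears fewer than $r$ times (possibly zero times) as a part of $\lambda$. Let $S_r(n)=\sum_{\lambda\vdash n}g_r(\lambda)$, the sum running over all partitions of $n$, and let $U_r(n)$ be the number of partitions of $n$ into parts not congruent to $0$, $r$ or $3r$ modulo $4r$. Then for all integers $n\ge 0$ and $r\ge 1$: (i) $\displaystyle\sum_{k=0}^\infty\bigl(p(n-rT_{4k})+p(n-rT_{4k+3})\bigr)=\frac{S_r(n)}{2}+\frac{U_r(n)}{2}$; (ii) $\displaystyle\sum_{k=0}^\infty\bigl(p(n-rT_{4k+1})+p(n-rT_{4k+2})\bigr)=\frac{S_r(n)}{2}-\frac{U_r(n)}{2}$. -/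

import Mathlib

namespace LeastGap

/-- The `k`-th triangular number `T_k = k (k + 1) / 2` (the division is exact). -/
def triangular (k : ℕ) : ℕ := k * (k + 1) / 2

/-- Euler's partition function `p` on the integers: the number of partitions of `m` if `m ≥ 0`,
and `0` if `m < 0`. -/
def partitionFn (m : ℤ) : ℕ :=
  if m < 0 then 0 else Fintype.card (Nat.Partition m.toNat)

/-- The least `r`-gap `g_r(μ)` of a partition `μ`: the smallest positive integer that appears
fewer than `r` times (possibly not at all) as a part of `μ`. Meaningful for `r ≥ 1`. -/
noncomputable def leastGap (r : ℕ) {n : ℕ} (μ : Nat.Partition n) : ℕ :=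
  sInf {i : ℕ | 0 < i ∧ μ.parts.count i < r}

/-- For `r ≥ 1` the least `r`-gap is attained, so it is a genuine minimum. -/
theorem isLeast_leastGap {r : ℕ} (hr : 1 ≤ r) {n : ℕ} (μ : Nat.Partition n) :
    IsLeast {i : ℕ | 0 < i ∧ μ.parts.count i < r} (leastGap r μ) := by
  have hne : {i : ℕ | 0 < i ∧ μ.parts.count i < r}.Nonempty := by
    refine ⟨n + 1, Nat.succ_pos n, ?_⟩
    have h : n + 1 ∉ μ.parts := fun h => by
      have := μ.le_of_mem_parts h
      omega
    rw [Multiset.count_eq_zero_of_notMem h]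
    omega
  exact ⟨Nat.sInf_mem hne, fun i hi => Nat.sInf_le hi⟩

/-- `S_r(n)`: the sum of the least `r`-gaps of all partitions of `n`. -/
noncomputable def gapSum (r n : ℕ) : ℕ := ∑ μ : Nat.Partition n, leastGap r μ

/-- `U_r(n)`: the number of partitions of `n` into parts not congruent to `0`, `r` or `3r`
modulo `4r`. -/
def restrictedCount (r n : ℕ) : ℕ :=
  (Nat.Partition.restricted n fun i =>
    ¬ i ≡ 0 [MOD 4 * r] ∧ ¬ i ≡ r [MOD 4 * r] ∧ ¬ i ≡ 3 * r [MOD 4 * r]).card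

end LeastGap

namespace LeastGap

open Finset

theorem two_mul_triangular (k : ℕ) : 2 * triangular k = k * (k + 1) :=
  Nat.mul_div_cancel' (Nat.even_mul_succ_self k).two_dvd

theorem triangular_even (n : ℕ) : triangular (2 * n) = n * (2 * n + 1) := by
  have := two_mul_triangular (2 * n)
  nlinarith

theorem triangular_odd (n : ℕ) : triangular (2 * n + 1) = (2 * n + 1) * (n + 1) := by
  have := two_mul_triangular (2 * n + 1)
  nlinarith

theorem triangular_succ (k : ℕ) : triangular (k + 1) = triangular k + (k + 1) := by
  have h1 := two_mul_triangular (k + 1)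
  have h2 := two_mul_triangular k
  nlinarith

theorem le_triangular (k : ℕ) : k ≤ triangular k := by
  have := two_mul_triangular k
  rcases k with _ | k
  · simp
  · nlinarith

section Gauss

variable {R : Type*} [CommRing R]

theorem sum_shanks_diff (x : R) (n m : ℕ) (hm : m ≤ n) :
    ∑ s ∈ range m, ((∏ j ∈ range s, (1 - x ^ (2 * j + 1))) *
          (∏ j ∈ Ico s (n + 1), (1 - x ^ (2 * j + 2))) * x ^ (s * (2 * (n + 1) + 1)) -
        (1 - x ^ (2 * n + 1)) * ((∏ j ∈ range s, (1 - x ^ (2 * j + 1))) *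
          (∏ j ∈ Ico s n, (1 - x ^ (2 * j + 2))) * x ^ (s * (2 * n + 1)))) =
      (∏ j ∈ range m, (1 - x ^ (2 * j + 1))) * (1 - x ^ (2 * m)) *
        (∏ j ∈ Ico m n, (1 - x ^ (2 * j + 2))) * x ^ (m * (2 * n + 1)) := by
  induction m with
  | zero => simp
  | succ m ih =>
    rw [sum_range_succ, ih (by omega), prod_range_succ, prod_Ico_succ_top (by omega : m ≤ n),
      prod_eq_prod_Ico_succ_bot (by omega : m < n)]
    ring

/-- Shanks' finite form of Gauss's identity for triangular numbers, cleared of denominators. -/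
theorem shanks_identity (x : R) (n : ℕ) :
    (∏ j ∈ range n, (1 - x ^ (2 * j + 1))) * ∑ k ∈ range (2 * n), x ^ triangular k =
      ∑ s ∈ range n, (∏ j ∈ range s, (1 - x ^ (2 * j + 1))) *
        (∏ j ∈ Ico s n, (1 - x ^ (2 * j + 2))) * x ^ (s * (2 * n + 1)) := by
  induction n with
  | zero => simp
  | succ n ih =>
    have h := sum_shanks_diff x n n le_rfl
    rw [sum_sub_distrib, ← mul_sum, ← ih, sub_eq_iff_eq_add] at h
    rw [sum_range_succ, h, show 2 * (n + 1) = 2 * n + 1 + 1 by ring, sum_range_succ,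
      sum_range_succ, triangular_even, triangular_odd, prod_range_succ]
    simp only [Ico_self, prod_empty, Nat.Ico_succ_singleton, prod_singleton]
    ring

theorem dvd_prod_one_sub_pow_sub_one {ι : Type*} (x : R) (a : ℕ) (s : Finset ι) (f : ι → ℕ)
    (h : ∀ i ∈ s, a ≤ f i) : x ^ a ∣ ∏ i ∈ s, (1 - x ^ f i) - 1 := by
  classical
  induction s using Finset.induction_on with
  | empty => simp
  | insert i s hi ih =>
    rw [prod_insert hi]
    have h1 := ih fun j hj => h j (mem_insert_of_mem hj)
    have h2 : x ^ a ∣ x ^ f i := pow_dvd_pow x (h i (mem_insert_self i s))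
    have e : (1 - x ^ f i) * ∏ j ∈ s, (1 - x ^ f j) - 1 =
        (∏ j ∈ s, (1 - x ^ f j) - 1) - x ^ f i * ∏ j ∈ s, (1 - x ^ f j) := by ring
    rw [e]
    exact dvd_sub h1 (h2.mul_right _)

theorem dvd_shanks_sub (x : R) (n : ℕ) :
    x ^ (2 * n) ∣ (∏ j ∈ range n, (1 - x ^ (2 * j + 1))) *
      (∑ k ∈ range (2 * n), x ^ triangular k) - ∏ j ∈ range n, (1 - x ^ (2 * j + 2)) := by
  rw [shanks_identity]
  rcases n with _ | n
  · simp
  · rw [sum_range_succ']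
    simp only [range_zero, prod_empty, zero_mul, pow_zero, mul_one, one_mul, Nat.Ico_zero_eq_range,
      add_sub_cancel_right]
    refine dvd_sum fun s _ => Dvd.dvd.mul_left (pow_dvd_pow x ?_) _
    nlinarith

/-- The truncated product side of Gauss's identity, as the product over residues `1, 3, 4`
modulo `4`. -/
theorem prod_range_odd_mul (q : R) (M : ℕ) :
    (∏ j ∈ range (2 * M), (1 + q ^ (2 * j + 1))) *
        ∏ j ∈ range M, ((1 - q ^ (4 * j + 1)) * (1 - q ^ (4 * j + 3)) * (1 - q ^ (4 * j + 4))) =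
      (∏ j ∈ range M, (1 - q ^ (4 * j + 4))) * ∏ j ∈ range (2 * M), (1 - q ^ (4 * j + 2)) := by
  induction M with
  | zero => simp
  | succ M ih =>
    rw [show 2 * (M + 1) = 2 * M + 1 + 1 by ring]
    simp only [prod_range_succ]
    linear_combination ((1 + q ^ (2 * (2 * M) + 1)) * (1 + q ^ (2 * (2 * M + 1) + 1)) *
      ((1 - q ^ (4 * M + 1)) * (1 - q ^ (4 * M + 3)) * (1 - q ^ (4 * M + 4)))) * ih

theorem prod_range_even (q : R) (M : ℕ) :
    ∏ j ∈ range (2 * M), (1 - q ^ (2 * j + 2)) =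
      (∏ j ∈ range M, (1 - q ^ (4 * j + 4))) * ∏ j ∈ range M, (1 - q ^ (4 * j + 2)) := by
  induction M with
  | zero => simp
  | succ M ih =>
    rw [show 2 * (M + 1) = 2 * M + 1 + 1 by ring]
    simp only [prod_range_succ]
    rw [ih]
    ring

theorem dvd_gauss_sub (q : R) (M : ℕ) :
    q ^ M ∣ (∏ j ∈ range (2 * M), (1 + q ^ (2 * j + 1))) *
      (∏ j ∈ range M, ((1 - q ^ (4 * j + 1)) * (1 - q ^ (4 * j + 3)) * (1 - q ^ (4 * j + 4))) -
        ∑ k ∈ range (4 * M), (-q) ^ triangular k) := by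
  have h1 := dvd_shanks_sub (-q) (2 * M)
  have e1 : ∀ j, 1 - (-q) ^ (2 * j + 1) = 1 + q ^ (2 * j + 1) := fun j => by
    rw [Odd.neg_pow ⟨j, rfl⟩]; ring
  have e2 : ∀ j, 1 - (-q) ^ (2 * j + 2) = 1 - q ^ (2 * j + 2) := fun j => by
    rw [Even.neg_pow ⟨j + 1, by ring⟩]
  simp only [e1, e2] at h1
  rw [Even.neg_pow (even_two_mul _), show 2 * (2 * M) = 4 * M by ring] at h1
  have h2 := dvd_prod_one_sub_pow_sub_one q M (Ico M (2 * M)) (fun j => 4 * j + 2)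
    (fun j hj => by have := (mem_Ico.1 hj).1; omega)
  have h3 := (pow_dvd_pow q (by omega : M ≤ 4 * M)).trans h1
  rw [mul_sub, prod_range_odd_mul]
  have h4 := prod_range_mul_prod_Ico (fun j => 1 - q ^ (4 * j + 2)) (by omega : M ≤ 2 * M)
  rw [prod_range_even] at h3
  rw [← h4]
  have := dvd_sub (h2.mul_left ((∏ j ∈ range M, (1 - q ^ (4 * j + 4))) *
    ∏ j ∈ range M, (1 - q ^ (4 * j + 2)))) h3
  convert this using 1
  ring

end Gauss

/-- The multiset in which each of `1, …, k` appears exactly `r` times. -/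
def staircase (r k : ℕ) : Multiset ℕ := r • (Multiset.range k).map (· + 1)

theorem count_staircase (r k i : ℕ) :
    (staircase r k).count i = if 0 < i ∧ i ≤ k then r else 0 := by
  rw [staircase, Multiset.count_nsmul]
  have hn : ((Multiset.range k).map (· + 1)).Nodup :=
    (Multiset.nodup_range k).map (add_left_injective 1)
  rw [Multiset.count_eq_of_nodup hn]
  have : i ∈ (Multiset.range k).map (· + 1) ↔ 0 < i ∧ i ≤ k := by
    simp only [Multiset.mem_map, Multiset.mem_range]
    constructor
    · rintro ⟨a, h, rfl⟩; omega
    · rintro ⟨h, h'⟩; exact ⟨i - 1, by omega, by omega⟩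
  simp [this]


theorem sum_staircase (r k : ℕ) : (staircase r k).sum = r * triangular k := by
  rw [staircase, Multiset.sum_nsmul, smul_eq_mul]
  congr 1
  induction k with
  | zero => rfl
  | succ k ih => simp [Multiset.range_succ, ih, triangular_succ, add_comm]

theorem staircase_le_iff (r k : ℕ) (s : Multiset ℕ) :
    staircase r k ≤ s ↔ ∀ i, 0 < i → i ≤ k → r ≤ s.count i := by
  simp only [Multiset.le_iff_count, count_staircase]
  refine ⟨fun h i h1 h2 => by simpa [h1, h2] using h i, fun h i => ?_⟩
  split_ifs with hi
  · exact h i hi.1 hi.2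
  · exact Nat.zero_le _

theorem lt_leastGap_iff {r : ℕ} (hr : 1 ≤ r) {n : ℕ} (μ : Nat.Partition n) (k : ℕ) :
    k < leastGap r μ ↔ staircase r k ≤ μ.parts := by
  have h := isLeast_leastGap hr μ
  rw [staircase_le_iff]
  constructor
  · intro hk i hi hik
    by_contra hc
    have := h.2 ⟨hi, not_le.1 hc⟩
    omega
  · intro hk
    by_contra hc
    exact absurd (hk _ h.1.1 (not_lt.1 hc)) (not_le.2 h.1.2)

theorem leastGap_le {r : ℕ} (hr : 1 ≤ r) {n : ℕ} (μ : Nat.Partition n) :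
    leastGap r μ ≤ n + 1 := by
  refine (isLeast_leastGap hr μ).2 ⟨n.succ_pos, ?_⟩
  rw [Multiset.count_eq_zero_of_notMem fun h => by have := μ.le_of_mem_parts h; omega]
  omega

/-- Removing a sub-multiset of positive integers from partitions of `n` that contain it. -/
def partitionSubEquiv (n : ℕ) (s : Multiset ℕ) (hs : ∀ i ∈ s, 0 < i) (h : s.sum ≤ n) :
    {μ : Nat.Partition n // s ≤ μ.parts} ≃ Nat.Partition (n - s.sum) where
  toFun μ :=
    { parts := μ.1.parts - s
      parts_pos := fun hi => μ.1.parts_pos (Multiset.mem_of_le (Multiset.sub_le_self _ _) hi)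
      parts_sum := by
        have := congrArg Multiset.sum (tsub_add_cancel_of_le μ.2)
        rw [Multiset.sum_add, μ.1.parts_sum] at this
        omega }
  invFun ν :=
    ⟨{ parts := ν.parts + s
       parts_pos := fun hi => (Multiset.mem_add.1 hi).elim (ν.parts_pos ·) (hs _)
       parts_sum := by rw [Multiset.sum_add, ν.parts_sum]; omega }, Multiset.le_add_left _ _⟩
  left_inv μ := Subtype.ext (Nat.Partition.ext (tsub_add_cancel_of_le μ.2))
  right_inv ν := Nat.Partition.ext (add_tsub_cancel_right _ _)

theorem card_staircase_le (n r k : ℕ) :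
    #{μ : Nat.Partition n | staircase r k ≤ μ.parts} =
      partitionFn ((n : ℤ) - (r : ℤ) * (triangular k : ℤ)) := by
  have hz : (n : ℤ) - (r : ℤ) * (triangular k : ℤ) = (n : ℤ) - ((r * triangular k : ℕ) : ℤ) := by
    push_cast; rfl
  rw [hz, partitionFn, ← sum_staircase]
  split_ifs with h
  · rw [card_eq_zero, filter_eq_empty_iff]
    intro μ _ hle
    obtain ⟨t, ht⟩ := Multiset.le_iff_exists_add.1 hle
    have := congrArg Multiset.sum ht
    rw [μ.parts_sum, Multiset.sum_add] at this
    omega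
  · have hle : (staircase r k).sum ≤ n := by omega
    rw [← Fintype.card_subtype, Fintype.card_congr (partitionSubEquiv n _ ?_ hle)]
    · rw [show ((n : ℤ) - ((staircase r k).sum : ℤ)).toNat = n - (staircase r k).sum by omega]
    · intro i hi
      have := Multiset.count_pos.2 hi
      rw [count_staircase] at this
      split_ifs at this with hc
      · exact hc.1
      · omega

theorem sum_partitionFn_eq_gapSum (n r K : ℕ) (hr : 1 ≤ r) (hK : n < K) :
    ∑ k ∈ range K, partitionFn ((n : ℤ) - (r : ℤ) * (triangular k : ℤ)) = gapSum r n := by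
  simp only [← card_staircase_le, card_filter, gapSum]
  rw [sum_comm]
  refine sum_congr rfl fun μ _ => ?_
  simp only [← lt_leastGap_iff hr]
  rw [← card_filter, show (range K).filter (· < leastGap r μ) = range (leastGap r μ) from ?_,
    card_range]
  ext k
  have := leastGap_le hr μ
  simp only [mem_filter, mem_range]
  omega

theorem add_modEq_iff_of_pos_le {m a y c : ℕ} (hy : 0 < y) (hym : y ≤ m) (hc : c < m) :
    m * a + y ≡ c [MOD m] ↔ y = c ∨ (y = m ∧ c = 0) := by
  rw [Nat.ModEq, Nat.mul_add_mod, Nat.mod_eq_of_lt hc]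
  rcases hym.lt_or_eq with h | rfl
  · rw [Nat.mod_eq_of_lt h]; omega
  · rw [Nat.mod_self]; omega

theorem prod_range_excluded {R : Type*} [CommRing R] (x : R) (r M : ℕ) (hr : 1 ≤ r) :
    ∏ i ∈ range (4 * r * M), (if ¬ i + 1 ≡ 0 [MOD 4 * r] ∧ ¬ i + 1 ≡ r [MOD 4 * r] ∧
        ¬ i + 1 ≡ 3 * r [MOD 4 * r] then 1 else 1 - x ^ (i + 1)) =
      ∏ j ∈ range M, ((1 - (x ^ r) ^ (4 * j + 1)) * (1 - (x ^ r) ^ (4 * j + 3)) *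
        (1 - (x ^ r) ^ (4 * j + 4))) := by
  induction M with
  | zero => simp
  | succ M ih =>
    rw [mul_add_one, prod_range_add, ih, prod_range_succ]
    congr 1
    have key : ∀ i ∈ range (4 * r), ((¬ 4 * r * M + i + 1 ≡ 0 [MOD 4 * r] ∧
        ¬ 4 * r * M + i + 1 ≡ r [MOD 4 * r] ∧ ¬ 4 * r * M + i + 1 ≡ 3 * r [MOD 4 * r]) ↔
        i ∉ ({r - 1, 3 * r - 1, 4 * r - 1} : Finset ℕ)) := by
      intro i hi
      rw [mem_range] at hi
      rw [add_assoc, add_modEq_iff_of_pos_le (by omega) (by omega) (by omega),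
        add_modEq_iff_of_pos_le (by omega) (by omega) (by omega),
        add_modEq_iff_of_pos_le (by omega) (by omega) (by omega)]
      simp only [mem_insert, mem_singleton, and_true]
      omega
    rw [prod_congr rfl fun i hi => by rw [if_congr (key i hi) rfl rfl],
      ← prod_subset (s₁ := {r - 1, 3 * r - 1, 4 * r - 1})]
    · rw [prod_congr rfl fun i hi => by rw [if_neg (not_not.2 hi)]]
      rw [prod_insert (by simp only [mem_insert, mem_singleton]; omega),
        prod_insert (by simp only [mem_singleton]; omega), prod_singleton]
      simp only [← pow_mul]
      rw [← mul_assoc (1 - _)]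
      rw [show 4 * r * M + (r - 1) + 1 = r * (4 * M + 1) by
          rw [add_assoc, Nat.sub_add_cancel hr]; ring,
        show 4 * r * M + (3 * r - 1) + 1 = r * (4 * M + 3) by
          rw [add_assoc, Nat.sub_add_cancel (by omega)]; ring,
        show 4 * r * M + (4 * r - 1) + 1 = r * (4 * M + 4) by
          rw [add_assoc, Nat.sub_add_cancel (by omega)]; ring]
    · intro i hi
      simp only [mem_insert, mem_singleton] at hi
      rw [mem_range]; omega
    · intro i _ hi
      rw [if_pos hi]

section PowerSeries

open PowerSeries Filter Topology
open scoped PowerSeries.WithPiTopology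

theorem coeff_tendsto_of_hasProd {f : ℕ → ℤ⟦X⟧} {g : ℤ⟦X⟧} (h : HasProd f g) (n : ℕ) :
    ∀ᶠ N in atTop, coeff n (∏ i ∈ range N, f i) = coeff n g := by
  have := (WithPiTopology.tendsto_iff_coeff_tendsto ℤ _ _ _).1 h.tendsto_prod_nat n
  rwa [nhds_discrete, tendsto_pure] at this

theorem prod_full_mul_prod_excluded (p : ℕ → Prop) [DecidablePred p] (N : ℕ) :
    (∏ i ∈ range N, ∑' j : ℕ, (X : ℤ⟦X⟧) ^ ((i + 1) * j)) *
        ∏ i ∈ range N, (if p (i + 1) then 1 else 1 - X ^ (i + 1)) =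
      ∏ i ∈ range N, (if p (i + 1) then ∑' j : ℕ, (X : ℤ⟦X⟧) ^ ((i + 1) * j) else 1) := by
  rw [← prod_mul_distrib]
  refine prod_congr rfl fun i _ => ?_
  split_ifs
  · rw [mul_one]
  · simp only [pow_mul]
    exact WithPiTopology.tsum_pow_mul_one_sub_of_constantCoeff_eq_zero (by simp)

theorem X_pow_dvd_gauss_sub (r M : ℕ) (hr : 1 ≤ r) :
    (X : ℤ⟦X⟧) ^ M ∣ ∏ j ∈ range M, ((1 - (X ^ r) ^ (4 * j + 1)) * (1 - (X ^ r) ^ (4 * j + 3)) *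
        (1 - (X ^ r) ^ (4 * j + 4))) - ∑ k ∈ range (4 * M), (-X ^ r) ^ triangular k := by
  have h := dvd_gauss_sub ((X : ℤ⟦X⟧) ^ r) M
  have hu : IsUnit (∏ j ∈ range (2 * M), (1 + ((X : ℤ⟦X⟧) ^ r) ^ (2 * j + 1))) := by
    rw [isUnit_iff_constantCoeff, map_prod]
    have : r ≠ 0 := by omega
    simp [this]
  rw [hu.dvd_mul_left, ← pow_mul] at h
  exact (pow_dvd_pow X (Nat.le_mul_of_pos_left M hr)).trans h

theorem X_pow_dvd_theta_sub (r K L : ℕ) (hr : 1 ≤ r) (hKL : K ≤ L) :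
    (X : ℤ⟦X⟧) ^ K ∣ ∑ k ∈ range L, (-X ^ r) ^ triangular k -
      ∑ k ∈ range K, (-X ^ r) ^ triangular k := by
  rw [← sum_range_add_sum_Ico _ hKL, add_sub_cancel_left]
  refine dvd_sum fun k hk => ?_
  rw [neg_pow, ← pow_mul]
  refine Dvd.dvd.mul_left (pow_dvd_pow X ?_) _
  have h1 := (mem_Ico.1 hk).1
  have h2 := le_triangular k
  have h3 := Nat.le_mul_of_pos_left (triangular k) hr
  omega

theorem coeff_eq_of_X_pow_dvd_sub {f g : ℤ⟦X⟧} {N n : ℕ} (h : (X : ℤ⟦X⟧) ^ N ∣ f - g)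
    (hn : n < N) : coeff n f = coeff n g := by
  have := X_pow_dvd_iff.1 h n hn
  rwa [map_sub, sub_eq_zero] at this

theorem coeff_mk_mul_theta (n r K : ℕ) :
    coeff n (PowerSeries.mk (fun m => (Fintype.card (Nat.Partition m) : ℤ)) *
        ∑ k ∈ range K, (-X ^ r) ^ triangular k) =
      ∑ k ∈ range K, (-1) ^ triangular k *
        (partitionFn ((n : ℤ) - (r : ℤ) * (triangular k : ℤ)) : ℤ) := by
  rw [mul_sum, map_sum]
  refine sum_congr rfl fun k _ => ?_
  rw [neg_pow, ← pow_mul, mul_left_comm, show ((-1 : ℤ⟦X⟧) ^ triangular k) =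
    C ((-1 : ℤ) ^ triangular k) by simp, coeff_C_mul, coeff_mul_X_pow']
  congr 1
  rw [← Nat.cast_mul, partitionFn]
  split_ifs with h1 h2 h2
  · omega
  · rw [coeff_mk, show ((n : ℤ) - ((r * triangular k : ℕ) : ℤ)).toNat = n - r * triangular k by
      omega]
  · rfl
  · omega

theorem coeff_mul_congr {f f' : ℤ⟦X⟧} (g : ℤ⟦X⟧) {n : ℕ}
    (h : ∀ m ≤ n, coeff m f = coeff m f') : coeff n (f * g) = coeff n (f' * g) := by
  rw [coeff_mul, coeff_mul]
  refine sum_congr rfl fun ij hij => ?_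
  rw [h _ (by rw [← mem_antidiagonal.1 hij]; omega)]

theorem sum_neg_one_pow_partitionFn (n r : ℕ) (hr : 1 ≤ r) :
    ∑ k ∈ range (4 * (n + 1)), (-1) ^ triangular k *
        (partitionFn ((n : ℤ) - (r : ℤ) * (triangular k : ℤ)) : ℤ) = restrictedCount r n := by
  have hfull : HasProd (fun i : ℕ => ∑' j : ℕ, (X : ℤ⟦X⟧) ^ ((i + 1) * j))
      (PowerSeries.mk fun m => (Fintype.card (Nat.Partition m) : ℤ)) := by
    simpa [Nat.Partition.restricted] using
      Nat.Partition.hasProd_powerSeriesMk_card_restricted ℤ fun _ => True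
  have hres := Nat.Partition.hasProd_powerSeriesMk_card_restricted ℤ fun i =>
    ¬ i ≡ 0 [MOD 4 * r] ∧ ¬ i ≡ r [MOD 4 * r] ∧ ¬ i ≡ 3 * r [MOD 4 * r]
  have hev : ∀ᶠ N in atTop, ∀ m ∈ Iic n, coeff m (∏ i ∈ range N, ∑' j : ℕ,
      (X : ℤ⟦X⟧) ^ ((i + 1) * j)) = (Fintype.card (Nat.Partition m) : ℤ) := by
    rw [eventually_all_finset]
    intro m _
    simpa using coeff_tendsto_of_hasProd hfull m
  obtain ⟨N₁, h₁⟩ := eventually_atTop.1 (hev.and (coeff_tendsto_of_hasProd hres n))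
  set M := max N₁ (n + 1) with hM
  have hMN : N₁ ≤ 4 * r * M :=
    (le_max_left _ _).trans (Nat.le_mul_of_pos_left _ (by omega))
  obtain ⟨hA, hC⟩ := h₁ _ hMN
  rw [← prod_full_mul_prod_excluded (fun i =>
    ¬ i ≡ 0 [MOD 4 * r] ∧ ¬ i ≡ r [MOD 4 * r] ∧ ¬ i ≡ 3 * r [MOD 4 * r]),
    prod_range_excluded _ _ _ hr, coeff_mk] at hC
  rw [← coeff_mk_mul_theta, restrictedCount, ← hC,
    ← coeff_mul_congr _ (fun m hm => (hA m (mem_Iic.2 hm)).trans (coeff_mk m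
      fun m => (Fintype.card (Nat.Partition m) : ℤ)).symm)]
  refine (coeff_eq_of_X_pow_dvd_sub (N := n + 1) ?_ n.lt_succ_self).symm
  rw [← mul_sub]
  refine Dvd.dvd.mul_left ?_ _
  have hnM : n + 1 ≤ M := le_max_right _ _
  have h2 := (pow_dvd_pow (X : ℤ⟦X⟧) hnM).trans (X_pow_dvd_gauss_sub r M hr)
  have h3 := (pow_dvd_pow (X : ℤ⟦X⟧) (by omega : n + 1 ≤ 4 * (n + 1))).trans
    (X_pow_dvd_theta_sub r (4 * (n + 1)) (4 * M) hr (by omega))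
  simpa using dvd_add h2 h3

end PowerSeries

theorem sum_range_four_mul {A : Type*} [AddCommMonoid A] (f : ℕ → A) (K : ℕ) :
    ∑ k ∈ range (4 * K), f k =
      ∑ k ∈ range K, (f (4 * k) + f (4 * k + 3)) +
        ∑ k ∈ range K, (f (4 * k + 1) + f (4 * k + 2)) := by
  induction K with
  | zero => simp
  | succ K ih =>
    rw [show 4 * (K + 1) = 4 * K + 1 + 1 + 1 + 1 by ring]
    simp only [sum_range_succ, ih]
    abel

theorem neg_one_pow_triangular (k : ℕ) :
    (-1 : ℤ) ^ triangular (4 * k) = 1 ∧ (-1 : ℤ) ^ triangular (4 * k + 1) = -1 ∧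
      (-1 : ℤ) ^ triangular (4 * k + 2) = -1 ∧ (-1 : ℤ) ^ triangular (4 * k + 3) = 1 := by
  have h0 : (-1 : ℤ) ^ triangular (4 * k) = 1 := by
    rw [show 4 * k = 2 * (2 * k) by ring, triangular_even, mul_assoc]
    exact (even_two_mul _).neg_one_pow
  have e (a : ℕ) : (-1 : ℤ) ^ (2 * a) = 1 := (even_two_mul a).neg_one_pow
  have h4 : (-1 : ℤ) ^ (4 * k) = 1 := by rw [show 4 * k = 2 * (2 * k) by ring, e]
  simp only [triangular_succ, pow_add, h0, h4]
  norm_num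

theorem partitionFn_eq_zero_of_lt {n r k : ℕ} (hr : 1 ≤ r) (h : n < k) :
    partitionFn ((n : ℤ) - (r : ℤ) * (triangular k : ℤ)) = 0 := by
  rw [partitionFn, if_pos]
  have h1 := le_triangular k
  have h2 := Nat.le_mul_of_pos_left (triangular k) hr
  have h3 : n < r * triangular k := by omega
  zify at h3
  linarith

theorem hasSum_partitionFn_triangular (n r : ℕ) (hr : 1 ≤ r) :
    HasSum (fun k : ℕ =>
        (partitionFn ((n : ℤ) - (r : ℤ) * (triangular (4 * k) : ℤ)) : ℚ)
          + (partitionFn ((n : ℤ) - (r : ℤ) * (triangular (4 * k + 3) : ℤ)) : ℚ))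
      ((gapSum r n : ℚ) / 2 + (restrictedCount r n : ℚ) / 2) ∧
    HasSum (fun k : ℕ =>
        (partitionFn ((n : ℤ) - (r : ℤ) * (triangular (4 * k + 1) : ℤ)) : ℚ)
          + (partitionFn ((n : ℤ) - (r : ℤ) * (triangular (4 * k + 2) : ℤ)) : ℚ))
      ((gapSum r n : ℚ) / 2 - (restrictedCount r n : ℚ) / 2) := by
  set f : ℕ → ℚ := fun k => (partitionFn ((n : ℤ) - (r : ℤ) * (triangular k : ℤ)) : ℚ) with hf
  have hS := sum_partitionFn_eq_gapSum n r (4 * (n + 1)) hr (by omega)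
  have hU := sum_neg_one_pow_partitionFn n r hr
  rw [sum_range_four_mul] at hS hU
  have hz : ∀ k, n < k → f k = 0 := fun k hk => by
    simp only [hf, partitionFn_eq_zero_of_lt hr hk, Nat.cast_zero]
  have hS' : ∑ k ∈ range (n + 1), (f (4 * k) + f (4 * k + 3)) +
      ∑ k ∈ range (n + 1), (f (4 * k + 1) + f (4 * k + 2)) = gapSum r n := by
    rw [← hS]; push_cast; rfl
  have hU' : ∑ k ∈ range (n + 1), (f (4 * k) + f (4 * k + 3)) -
      ∑ k ∈ range (n + 1), (f (4 * k + 1) + f (4 * k + 2)) = restrictedCount r n := by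
    have h := congrArg (Int.cast : ℤ → ℚ) hU
    simp only [fun k => (neg_one_pow_triangular k).1, fun k => (neg_one_pow_triangular k).2.1,
      fun k => (neg_one_pow_triangular k).2.2.1, fun k => (neg_one_pow_triangular k).2.2.2,
      one_mul, neg_one_mul, ← neg_add] at h
    push_cast at h
    rw [sum_neg_distrib, ← sub_eq_add_neg] at h
    exact h
  have h0 := hasSum_sum_of_ne_finset_zero (L := .unconditional ℕ)
    (f := fun k => f (4 * k) + f (4 * k + 3))
    (s := range (n + 1)) fun k hk => by
      rw [mem_range] at hk
      rw [hz _ (by omega), hz _ (by omega), add_zero]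
  have h1 := hasSum_sum_of_ne_finset_zero (L := .unconditional ℕ)
    (f := fun k => f (4 * k + 1) + f (4 * k + 2))
    (s := range (n + 1)) fun k hk => by
      rw [mem_range] at hk
      rw [hz _ (by omega), hz _ (by omega), add_zero]
  constructor
  · convert h0 using 1
    linarith
  · convert h1 using 1
    linarith

end LeastGap

theorem theorem2 (n r : ℕ) (hr : 1 ≤ r) :
    HasSum (fun k : ℕ =>
        (LeastGap.partitionFn ((n : ℤ) - (r : ℤ) * (LeastGap.triangular (4 * k) : ℤ)) : ℚ)
          + (LeastGap.partitionFn ((n : ℤ) - (r : ℤ) * (LeastGap.triangular (4 * k + 3) : ℤ)) : ℚ))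
      ((LeastGap.gapSum r n : ℚ) / 2 + (LeastGap.restrictedCount r n : ℚ) / 2) ∧
    HasSum (fun k : ℕ =>
        (LeastGap.partitionFn ((n : ℤ) - (r : ℤ) * (LeastGap.triangular (4 * k + 1) : ℤ)) : ℚ)
          + (LeastGap.partitionFn ((n : ℤ) - (r : ℤ) * (LeastGap.triangular (4 * k + 2) : ℤ)) : ℚ))
      ((LeastGap.gapSum r n : ℚ) / 2 - (LeastGap.restrictedCount r n : ℚ) / 2) :=
  LeastGap.hasSum_partitionFn_triangular n r hr
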